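/- Let $k$ be a field of characteristic zero and let $Q$ be a toupie quiver: a finite quiver without oriented cycles that has a unique source $0$ and a unique sink $\omega$, and in which every other vertex is the source of exactly one arrow and the target of exactly one arrow. Let $I\subset kQ$ be an admissible ideal and $A=kQ/I$ the corresponding toupie algebra. The branches are the paths from $0$ to $\omega$; a branch contains a monomial relation if some subpath of it lies in $I$. Suppose that the number $a$ of arrows from $0$ to $\omega$ is positive. For each branch $\alpha^{(i)}$ containing a monomial relation, with first arrow $\alpha^{i}_{0}$, there is a derivation $\alpha^i_0\|\alpha^i_0$ of $A$ that vanishes on the trivial paths, fixes (the class of) $\alpha^{i}_{0}$ and sends every other arrow to $0$; let $y_i$ be its class in $HH^1(A)=\mathrm{Der}_k(A)/\mathrm{Inn}(A)$, which is a Lie algebra under the Gerstenhaber bracket $[f,g]=f\circ g-g\circ f$. Then the centre of the Lie algebra $HH^1(A)$ is the $k$-vector space spanned by the classes $y_i$, where $\alpha^{(i)}$ runs over the branches containing monomial relations. -/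

import Mathlib

universe u v w

/-- The set of all paths of a quiver (including the trivial paths), each together with its source
and its target. -/
abbrev QPath (V : Type u) [Quiver.{v} V] : Type (max u v) := Σ x y : V, Quiver.Path x y

/-- The set `Q₁` of all arrows of a quiver. -/
abbrev QArrow (V : Type u) [Quiver.{v} V] : Type (max u v) := Σ x y : V, (x ⟶ y)

/-- The path algebra `kQ`: the vector space with basis the paths of `Q`. Paths are concatenated
from left to right: `p * q` is "first `p`, then `q`", and it is zero if `q` does not start where
`p` ends. -/
def PathAlgebra (k : Type w) (V : Type u) [Field k] [Quiver.{v} V] : Type (max u v w) :=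
  QPath V →₀ k

namespace PathAlgebra

noncomputable section

variable {k : Type w} {V : Type u} [Field k] [Quiver.{v} V]

instance : AddCommGroup (PathAlgebra k V) := inferInstanceAs (AddCommGroup (QPath V →₀ k))

instance : Module k (PathAlgebra k V) := inferInstanceAs (Module k (QPath V →₀ k))

variable (k) in
/-- The basis element of the path algebra given by a path. -/
def of {x y : V} (p : Quiver.Path x y) : PathAlgebra k V :=
  Finsupp.single (⟨x, y, p⟩ : QPath V) (1 : k)

theorem induction_on {P : PathAlgebra k V → Prop} (a : PathAlgebra k V) (h0 : P 0)
    (hadd : ∀ a b, P a → P b → P (a + b))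
    (hof : ∀ (c : k) (x y : V) (p : Quiver.Path x y), P (c • of k p)) : P a := by
  refine Finsupp.induction_linear (motive := P) a h0 hadd ?_
  rintro ⟨x, y, p⟩ c
  have h : (Finsupp.single ⟨x, y, p⟩ c : QPath V →₀ k) = c • Finsupp.single ⟨x, y, p⟩ 1 := by simp
  rw [h]
  exact hof c x y p

variable [DecidableEq V]

variable (k) in
/-- The product of two paths: their concatenation if they are composable, and zero otherwise. -/
def mulPath (p q : QPath V) : PathAlgebra k V :=
  if h : q.1 = p.2.1 then of k (p.2.2.comp (q.2.2.cast h rfl)) else 0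

variable (k V) in
/-- The bilinear extension of the product of paths. -/
def mulHom : PathAlgebra k V →ₗ[k] PathAlgebra k V →ₗ[k] PathAlgebra k V :=
  Finsupp.linearCombination k fun p : QPath V =>
    (Finsupp.linearCombination k fun q : QPath V => mulPath k p q :
      (QPath V →₀ k) →ₗ[k] PathAlgebra k V)

theorem mulHom_of {x y x' y' : V} (p : Quiver.Path x y) (q : Quiver.Path x' y') :
    mulHom k V (of k p) (of k q) = mulPath k ⟨x, y, p⟩ ⟨x', y', q⟩ := by
  simp only [mulHom, of]
  erw [Finsupp.linearCombination_single, one_smul, Finsupp.linearCombination_single, one_smul]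

theorem mulHom_of_comp {x y z : V} (p : Quiver.Path x y) (q : Quiver.Path y z) :
    mulHom k V (of k p) (of k q) = of k (p.comp q) := by
  rw [mulHom_of, mulPath, dif_pos rfl]
  rfl

theorem mulHom_of_ne {x y x' z : V} (p : Quiver.Path x y) (q : Quiver.Path x' z) (h : x' ≠ y) :
    mulHom k V (of k p) (of k q) = 0 := by
  rw [mulHom_of, mulPath, dif_neg h]

instance : Mul (PathAlgebra k V) := ⟨fun a b => mulHom k V a b⟩

theorem mul_def (a b : PathAlgebra k V) : a * b = mulHom k V a b := rfl

theorem of_mul_of {x y z : V} (p : Quiver.Path x y) (q : Quiver.Path y z) :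
    of k p * of k q = of k (p.comp q) := mulHom_of_comp p q

theorem of_mul_of_ne {x y x' z : V} (p : Quiver.Path x y) (q : Quiver.Path x' z) (h : x' ≠ y) :
    of k p * of k q = 0 := mulHom_of_ne p q h

theorem of_mul_of_mul_of {x y x' y' x'' y'' : V} (p : Quiver.Path x y) (q : Quiver.Path x' y')
    (r : Quiver.Path x'' y'') : of k p * of k q * of k r = of k p * (of k q * of k r) := by
  by_cases h : x' = y
  · subst h
    by_cases h' : x'' = y'
    · subst h'
      simp only [of_mul_of, Quiver.Path.comp_assoc]
    · rw [of_mul_of, of_mul_of_ne _ _ h', of_mul_of_ne _ _ h', mul_def, map_zero]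
  · by_cases h' : x'' = y'
    · subst h'
      rw [of_mul_of, of_mul_of_ne _ _ h, of_mul_of_ne _ _ h, mul_def, map_zero,
        LinearMap.zero_apply]
    · rw [of_mul_of_ne _ _ h, of_mul_of_ne _ _ h', mul_def, mul_def, map_zero, map_zero,
        LinearMap.zero_apply]

instance : NonUnitalNonAssocRing (PathAlgebra k V) where
  left_distrib a b c := by simp only [mul_def, map_add]
  right_distrib a b c := by simp only [mul_def, map_add, LinearMap.add_apply]
  zero_mul a := by simp only [mul_def, map_zero, LinearMap.zero_apply]
  mul_zero a := by simp only [mul_def, map_zero]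

instance : IsScalarTower k (PathAlgebra k V) (PathAlgebra k V) :=
  ⟨fun c a b => by simp only [smul_eq_mul, mul_def, map_smul, LinearMap.smul_apply]⟩

instance : SMulCommClass k (PathAlgebra k V) (PathAlgebra k V) :=
  ⟨fun c a b => by simp only [smul_eq_mul, mul_def, map_smul]⟩

theorem mul_assoc_aux (a b c : PathAlgebra k V) : a * b * c = a * (b * c) := by
  induction a using induction_on with
  | h0 => simp only [zero_mul]
  | hadd a a' h h' => simp only [add_mul, h, h']
  | hof l x y p =>
    induction b using induction_on with
    | h0 => simp only [zero_mul, mul_zero]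
    | hadd b b' h h' => simp only [add_mul, mul_add, h, h']
    | hof m x' y' q =>
      induction c using induction_on with
      | h0 => simp only [mul_zero]
      | hadd c c' h h' => simp only [mul_add, h, h']
      | hof n x'' y'' r =>
        simp only [smul_mul_assoc, mul_smul_comm, of_mul_of_mul_of]

variable [Fintype V]

/-- The unit of the path algebra is the sum of the trivial paths `e_x`. -/
instance : One (PathAlgebra k V) := ⟨∑ x : V, of k (Quiver.Path.nil : Quiver.Path x x)⟩

theorem one_def : (1 : PathAlgebra k V) = ∑ x : V, of k (Quiver.Path.nil : Quiver.Path x x) := rfl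

theorem one_mul_aux (a : PathAlgebra k V) : 1 * a = a := by
  induction a using induction_on with
  | h0 => simp only [mul_zero]
  | hadd a b h h' => simp only [mul_add, h, h']
  | hof c x y p =>
    rw [mul_smul_comm, one_def, Finset.sum_mul, Finset.sum_eq_single x]
    · rw [of_mul_of, Quiver.Path.nil_comp]
    · intro z _ hz
      exact of_mul_of_ne _ _ (Ne.symm hz)
    · intro h
      exact absurd (Finset.mem_univ x) h

theorem mul_one_aux (a : PathAlgebra k V) : a * 1 = a := by
  induction a using induction_on with
  | h0 => simp only [zero_mul]
  | hadd a b h h' => simp only [add_mul, h, h']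
  | hof c x y p =>
    rw [smul_mul_assoc, one_def, Finset.mul_sum, Finset.sum_eq_single y]
    · rw [of_mul_of, Quiver.Path.comp_nil]
    · intro z _ hz
      exact of_mul_of_ne _ _ hz
    · intro h
      exact absurd (Finset.mem_univ y) h

instance : Ring (PathAlgebra k V) :=
  { (inferInstance : NonUnitalNonAssocRing (PathAlgebra k V)),
    (inferInstance : One (PathAlgebra k V)) with
    mul_assoc := mul_assoc_aux
    one_mul := one_mul_aux
    mul_one := mul_one_aux }

instance : Algebra k (PathAlgebra k V) :=
  Algebra.ofModule (fun c a b => smul_mul_assoc c a b) (fun c a b => mul_smul_comm c a b)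

end

end PathAlgebra

/-- A (finite) quiver is toupie, with source `s` and sink `t`: `s` is its unique source, `t` its
unique sink, every other vertex is the source of exactly one arrow and the target of exactly one
arrow, and there are no oriented cycles. -/
structure IsToupie {V : Type u} [Quiver.{v} V] (s t : V) : Prop where
  source_iff : ∀ x : V, (∀ y : V, IsEmpty (y ⟶ x)) ↔ x = s
  sink_iff : ∀ x : V, (∀ y : V, IsEmpty (x ⟶ y)) ↔ x = t
  exists_unique_out : ∀ x : V, x ≠ s → x ≠ t → Nonempty (Unique (Σ y : V, (x ⟶ y)))
  exists_unique_in : ∀ x : V, x ≠ s → x ≠ t → Nonempty (Unique (Σ y : V, (y ⟶ x)))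
  acyclic : ∀ (x : V) (p : Quiver.Path x x), p = Quiver.Path.nil

section Toupie

variable {k : Type w} {V : Type u} [Field k] [Quiver.{v} V] [DecidableEq V] [Fintype V]

/-- An ideal `I` of `kQ` is admissible if `J ^ N ⊆ I ⊆ J ^ 2` for some `N ≥ 2`, where `J` is the
ideal generated by the arrows; note that `J ^ n` is the span of the paths of length at least `n`. -/
def IsAdmissible (I : Ideal (PathAlgebra k V)) : Prop :=
  (∀ f ∈ I, f ∈ Submodule.span k
    {g : PathAlgebra k V | ∃ (x y : V) (p : Quiver.Path x y), 2 ≤ p.length ∧ g = PathAlgebra.of k p}) ∧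
  ∃ N : ℕ, 2 ≤ N ∧ ∀ (x y : V) (p : Quiver.Path x y), N ≤ p.length → PathAlgebra.of k p ∈ I

variable (I : Ideal (PathAlgebra k V))

/-- A path contains a monomial relation if some subpath of it is zero in `kQ / I`. -/
def ContainsMonomialRelation {x y : V} (p : Quiver.Path x y) : Prop :=
  ∃ (x' y' : V) (u : Quiver.Path x x') (r : Quiver.Path x' y') (v : Quiver.Path y' y),
    p = u.comp (r.comp v) ∧ PathAlgebra.of k r ∈ I

variable [I.IsTwoSided]

/-- The class in `kQ / I` of a path. -/
noncomputable def pathClass {x y : V} (p : Quiver.Path x y) : PathAlgebra k V ⧸ I :=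
  Ideal.Quotient.mk I (PathAlgebra.of k p)

end Toupie

attribute [local instance] LieRing.ofAssociativeRing

section Hochschild

variable (k : Type w) [Field k] (A : Type u) [Ring A] [Algebra k A]

/-- The `k`-linear derivations of `A`, that is, the `1`-cocycles of the Hochschild complex of `A`
with coefficients in `A`. The Gerstenhaber bracket of `1`-cochains is
`[f, g] = f ∘ g - g ∘ f`. -/
def derivations : LieSubalgebra k (Module.End k A) where
  carrier := {f | ∀ a b : A, f (a * b) = a * f b + f a * b}
  add_mem' {f g} hf hg a b := by
    simp only [LinearMap.add_apply, hf a b, hg a b]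
    noncomm_ring
  zero_mem' a b := by simp
  smul_mem' c f hf a b := by
    simp only [LinearMap.smul_apply, hf a b, smul_add, mul_smul_comm, smul_mul_assoc]
  lie_mem' {f g} hf hg a b := by
    simp only [Ring.lie_def, LinearMap.sub_apply, Module.End.mul_apply, hf a b, hg a b, map_add,
      hf _ _, hg _ _]
    noncomm_ring

/-- The inner derivations `x ↦ c x - x c`, that is, the `1`-coboundaries of the Hochschild
complex. -/
def innerDerivations : LieIdeal k (derivations k A) where
  carrier := {f | ∃ c : A, ∀ x : A, f.1 x = c * x - x * c}
  add_mem' := by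
    rintro f g ⟨c, hc⟩ ⟨d, hd⟩
    refine ⟨c + d, fun x => ?_⟩
    change f.1 x + g.1 x = _
    rw [hc, hd]
    noncomm_ring
  zero_mem' := ⟨0, fun x => by simp⟩
  smul_mem' := by
    rintro l f ⟨c, hc⟩
    refine ⟨l • c, fun x => ?_⟩
    change l • f.1 x = _
    rw [hc, smul_sub, smul_mul_assoc, mul_smul_comm]
  lie_mem := by
    rintro f g ⟨c, hc⟩
    refine ⟨f.1 c, fun x => ?_⟩
    change f.1 (g.1 x) - g.1 (f.1 x) = _
    rw [hc, hc, map_sub, f.2, f.2]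
    noncomm_ring

/-- The first Hochschild cohomology space `HH¹(A)`, cocycles modulo coboundaries, with the Lie
algebra structure given by the Gerstenhaber bracket. -/
abbrev HH1 : Type u := derivations k A ⧸ innerDerivations k A

end Hochschild

/-- The derivation `d` of `A = kQ / I` is the cocycle `α ‖ h`: it vanishes on the trivial paths,
sends the arrow `α` to `h`, and every other arrow to zero. -/
def IsParallelCocycle {k : Type w} {V : Type u} [Field k] [Quiver.{v} V] [DecidableEq V]
    [Fintype V] (I : Ideal (PathAlgebra k V)) [I.IsTwoSided]
    (d : derivations k (PathAlgebra k V ⧸ I)) (α : QArrow V) (h : PathAlgebra k V ⧸ I) : Prop :=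
  (∀ x : V, d.1 (pathClass I (Quiver.Path.nil : Quiver.Path x x)) = 0) ∧
  d.1 (pathClass I α.2.2.toPath) = h ∧
  ∀ β : QArrow V, β ≠ α → d.1 (pathClass I β.2.2.toPath) = 0

/-! ### Splitting off the first arrow of a path. -/

namespace Quiver.Path

/-! Modulo inner derivations every derivation kills the trivial paths (`exists_normalized_sub`) and
hence preserves the corners `e_x A e_y`. In a toupie quiver parallel paths coincide unless they are
branches, so a normalized derivation scales every arrow except those from `s` to `t`, which it sends
to combinations of branches.

A branch containing a monomial relation is zero in `A`, so the derivation scaling its first arrow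
kills all branches. It therefore commutes with every normalized derivation (`lie_parallelCocycle`),
and its class is central.

Conversely, let `z` be normalized with central class, and bracket it with the derivation sending a
direct arrow `g₀` to a branch `r` and the other arrows to zero. The bracket is inner, so it acts on
the direct arrows by one scalar. Modulo longer paths it is a commutator of operators on their span,
so it has trace zero; as the number of direct arrows is invertible in `k`, the scalar is zero. Hence
`z` multiplies all branches by a common `μ` (`exists_smul_branch`). Subtracting the inner derivation
of a suitable potential on the vertices then leaves only multiples of the first arrows of vanishing
branches (`exists_eq_sum_add_inner`). -/

theorem exists_eq_toPath_comp {V : Type u} [Quiver.{v} V] {x y : V} (p : Path x y) (h : x ≠ y) :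
    ∃ (z : V) (α : x ⟶ z) (q : Path z y), p = α.toPath.comp q := by
  have hp : p.length ≠ 0 := fun h0 => h (p.eq_of_length_zero h0)
  obtain ⟨n, hn⟩ := Nat.exists_eq_succ_of_ne_zero hp
  obtain ⟨z, α, q, -, hq⟩ := p.eq_toPath_comp_of_length_eq_succ hn
  exact ⟨z, α, q, hq⟩

theorem toPath_comp_inj {V : Type u} [Quiver.{v} V] {x z z' y : V} {α : x ⟶ z} {q : Path z y}
    {α' : x ⟶ z'} {q' : Path z' y} (h : α.toPath.comp q = α'.toPath.comp q') :
    (⟨z, α⟩ : Σ z, (x ⟶ z)) = ⟨z', α'⟩ := by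
  induction q with
  | nil =>
    cases q' with
    | nil =>
      simp only [comp_nil] at h
      cases h
      rfl
    | cons q' b =>
      have := congrArg length h
      simp [length_comp, Hom.toPath] at this
  | cons q b ih =>
    cases q' with
    | nil =>
      have := congrArg length h
      simp [length_comp, Hom.toPath] at this
    | cons q' b' =>
      simp only [comp_cons] at h
      have h1 := obj_eq_of_cons_eq_cons h
      subst h1
      exact ih (eq_of_heq (heq_of_cons_eq_cons h))

end Quiver.Path

/-! ### Paths in a toupie quiver. -/

namespace IsToupie

open Quiver

variable {V : Type u} [Quiver.{v} V] {s t : V}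

theorem isEmpty_hom_source (hQ : IsToupie s t) (x : V) : IsEmpty (x ⟶ s) :=
  (hQ.source_iff s).2 rfl x

theorem isEmpty_sink_hom (hQ : IsToupie s t) (x : V) : IsEmpty (t ⟶ x) :=
  (hQ.sink_iff t).2 rfl x

theorem path_to_source (hQ : IsToupie s t) {x : V} (p : Path x s) (h : x ≠ s) : False := by
  cases p with
  | nil => exact h rfl
  | cons p a => exact (hQ.isEmpty_hom_source _).false a

theorem path_from_sink (hQ : IsToupie s t) {y : V} (p : Path t y) : y = t := by
  by_contra h
  obtain ⟨z, α, -⟩ := p.exists_eq_toPath_comp (Ne.symm h)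
  exact (hQ.isEmpty_sink_hom _).false α

/-- Away from the sink each vertex has at most one incoming arrow, so a path can be traced backwards
without choice; acyclicity settles the case where one path is trivial. -/
theorem path_unique_of_ne_sink (hQ : IsToupie s t) {x y : V} (hy : y ≠ t) (p q : Path x y) :
    p = q := by
  induction p with
  | nil => exact (hQ.acyclic _ q).symm
  | cons p a ih =>
    rename_i b c
    cases q with
    | nil => exact hQ.acyclic _ _
    | cons q a' =>
      rename_i b'
      have hc : c ≠ s := by
        rintro rfl
        exact (hQ.isEmpty_hom_source _).false a
      obtain ⟨hu⟩ := hQ.exists_unique_in c hc hy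
      have h : (⟨b, a⟩ : Σ y : V, (y ⟶ c)) = ⟨b', a'⟩ := Subsingleton.elim _ _
      cases h
      have hb : b ≠ t := by
        rintro rfl
        exact (hQ.isEmpty_sink_hom _).false a
      rw [ih hb q]

theorem path_unique_of_ne_source (hQ : IsToupie s t) {x y : V} (hx : x ≠ s) (p q : Path x y) :
    p = q := by
  generalize hn : p.length = n
  induction n generalizing x with
  | zero =>
    obtain rfl := p.eq_of_length_zero hn
    rw [hQ.acyclic _ p, hQ.acyclic _ q]
  | succ n ih =>
    by_cases hxy : x = y
    · subst hxy
      rw [hQ.acyclic _ p, hQ.acyclic _ q]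
    obtain ⟨z, a, p, rfl⟩ := p.exists_eq_toPath_comp hxy
    obtain ⟨z', a', q, rfl⟩ := q.exists_eq_toPath_comp hxy
    have ht : x ≠ t := by
      rintro rfl
      exact (hQ.isEmpty_sink_hom _).false a
    obtain ⟨hu⟩ := hQ.exists_unique_out x hx ht
    have h : (⟨z, a⟩ : Σ y : V, (x ⟶ y)) = ⟨z', a'⟩ := Subsingleton.elim _ _
    cases h
    have hz : z ≠ s := by
      rintro rfl
      exact (hQ.isEmpty_hom_source _).false a
    simp only [Path.length_comp, Path.length_toPath] at hn
    rw [ih hz p q (by omega)]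

/-- This makes every corner of `A` other than `e_s A e_t` at most one-dimensional. -/
theorem path_unique (hQ : IsToupie s t) {x y : V} (h : ¬(x = s ∧ y = t)) (p q : Path x y) :
    p = q := by
  by_cases hx : x = s
  · exact hQ.path_unique_of_ne_sink (fun hy => h ⟨hx, hy⟩) p q
  · exact hQ.path_unique_of_ne_source hx p q

theorem exists_path_to_sink [Finite V] (hQ : IsToupie s t) (x : V) : Nonempty (Path x t) := by
  -- Reachability by a nontrivial path is a strict order by acyclicity, hence well-founded on a
  -- finite vertex set.
  let r : V → V → Prop := fun y x => ∃ p : Path x y, p.length ≠ 0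
  have : IsTrans V r := ⟨by
    rintro a b c ⟨p, hp⟩ ⟨q, hq⟩
    exact ⟨q.comp p, by rw [Path.length_comp]; omega⟩⟩
  have : Std.Irrefl r := ⟨by
    rintro a ⟨p, hp⟩
    rw [hQ.acyclic _ p] at hp
    exact hp rfl⟩
  have hwf : WellFounded r := Finite.wellFounded_of_trans_of_irrefl r
  induction x using hwf.induction with
  | _ x ih =>
    by_cases hx : x = t
    · subst hx
      exact ⟨Path.nil⟩
    · have hx' := mt (hQ.sink_iff x).1 hx
      simp only [not_forall, not_isEmpty_iff] at hx'
      obtain ⟨y, ⟨a⟩⟩ := hx'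
      obtain ⟨q⟩ := ih y ⟨a.toPath, by simp [Hom.toPath]⟩
      exact ⟨a.toPath.comp q⟩

end IsToupie

/-! ### The quotient algebra, its corners, and derivations given on paths. -/

namespace PathAlgebra

variable {k : Type w} {V : Type u} [Field k] [Quiver.{v} V]

/-- The linear map on the path algebra with prescribed values on the paths. -/
noncomputable def lift {M : Type*} [AddCommGroup M] [Module k M] (F : QPath V → M) :
    PathAlgebra k V →ₗ[k] M :=
  (Finsupp.linearCombination k F : (QPath V →₀ k) →ₗ[k] M)

theorem lift_of {M : Type*} [AddCommGroup M] [Module k M] (F : QPath V → M) {x y : V}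
    (p : Quiver.Path x y) : lift F (of k p) = F ⟨x, y, p⟩ := by
  simp only [lift, of]
  erw [Finsupp.linearCombination_single, one_smul]

end PathAlgebra

section QuotientAlgebra

open Quiver PathAlgebra

variable {k : Type w} {V : Type u} [Field k] [Quiver.{v} V] [DecidableEq V] [Fintype V]
  (I : Ideal (PathAlgebra k V)) [I.IsTwoSided]

theorem pathClass_mul {x y z : V} (p : Path x y) (q : Path y z) :
    pathClass I p * pathClass I q = pathClass I (p.comp q) := by
  rw [pathClass, pathClass, ← map_mul, of_mul_of, pathClass]

theorem pathClass_mul_of_ne {x y x' z : V} (p : Path x y) (q : Path x' z) (h : x' ≠ y) :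
    pathClass I p * pathClass I q = 0 := by
  rw [pathClass, pathClass, ← map_mul, of_mul_of_ne _ _ h, map_zero]

theorem pathClass_nil_mul_self (x : V) : pathClass I (Path.nil : Path x x) *
    pathClass I (Path.nil : Path x x) = pathClass I (Path.nil : Path x x) := by
  rw [pathClass_mul, Path.nil_comp]

theorem pathClass_eq_zero_iff {x y : V} (p : Path x y) : pathClass I p = 0 ↔ of k p ∈ I :=
  Ideal.Quotient.eq_zero_iff_mem

theorem pathClass_eq_zero_of_containsMonomialRelation {x y : V} {p : Path x y}
    (h : ContainsMonomialRelation I p) : pathClass I p = 0 := by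
  obtain ⟨x', y', u, r, v, rfl, hr⟩ := h
  rw [← pathClass_mul, ← pathClass_mul, (pathClass_eq_zero_iff I r).2 hr, zero_mul, mul_zero]

theorem containsMonomialRelation_of_pathClass_eq_zero {x y : V} {p : Path x y}
    (h : pathClass I p = 0) : ContainsMonomialRelation I p :=
  ⟨x, y, Path.nil, p, Path.nil, by simp, (pathClass_eq_zero_iff I p).1 h⟩

theorem sum_pathClass_nil : ∑ x : V, pathClass I (Path.nil : Path x x) = 1 := by
  simp only [pathClass]
  rw [← map_sum, ← one_def, map_one]

/-- A linear map on `kQ` vanishing on `I` factors through `kQ / I`. -/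
theorem exists_quotient_lift {M : Type*} [AddCommGroup M] [Module k M]
    (D : PathAlgebra k V →ₗ[k] M) (hD : ∀ f ∈ I, D f = 0) :
    ∃ D' : (PathAlgebra k V ⧸ I) →ₗ[k] M, ∀ f, D' (Ideal.Quotient.mk I f) = D f := by
  let π : PathAlgebra k V →ₗ[k] PathAlgebra k V ⧸ I := (Ideal.Quotient.mkₐ k I).toLinearMap
  have hπ : Function.Surjective π := Ideal.Quotient.mk_surjective
  -- A linear section of the quotient map; its choice is immaterial because `D` kills `I`.
  obtain ⟨σ, hσ⟩ := π.exists_rightInverse_of_surjective (LinearMap.range_eq_top.2 hπ)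
  refine ⟨D ∘ₗ σ, fun f => ?_⟩
  have h : π (σ (π f)) = π f := LinearMap.congr_fun hσ (π f)
  rw [← sub_eq_zero, ← map_sub] at h
  have h' := hD _ (Ideal.Quotient.eq_zero_iff_mem.1 h)
  rw [map_sub, sub_eq_zero] at h'
  exact h'

theorem induction_pathClass {P : PathAlgebra k V ⧸ I → Prop} (a : PathAlgebra k V ⧸ I) (h0 : P 0)
    (hadd : ∀ a b, P a → P b → P (a + b)) (hsmul : ∀ (c : k) a, P a → P (c • a))
    (hof : ∀ (x y : V) (p : Path x y), P (pathClass I p)) : P a := by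
  obtain ⟨f, rfl⟩ := Ideal.Quotient.mk_surjective a
  induction f using PathAlgebra.induction_on with
  | h0 => rwa [map_zero]
  | hadd a b ha hb =>
    rw [map_add]
    exact hadd _ _ ha hb
  | hof c x y p => exact hsmul c _ (hof x y p)

theorem of_nil_mul_mul_of_nil_mem_span (x y : V) (f : PathAlgebra k V) :
    of k (Path.nil : Path x x) * f * of k (Path.nil : Path y y) ∈
      Submodule.span k (Set.range fun p : Path x y => of k p) := by
  induction f using PathAlgebra.induction_on with
  | h0 =>
    rw [mul_zero, zero_mul]
    exact zero_mem _
  | hadd a b ha hb =>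
    rw [mul_add, add_mul]
    exact add_mem ha hb
  | hof c x' y' p =>
    rw [mul_smul_comm, smul_mul_assoc]
    refine Submodule.smul_mem _ _ ?_
    by_cases hx : x' = x
    · subst hx
      by_cases hy : y = y'
      · subst hy
        rw [of_mul_of, of_mul_of]
        exact Submodule.subset_span ⟨p, by simp⟩
      · rw [of_mul_of, of_mul_of_ne _ _ hy]
        exact zero_mem _
    · rw [of_mul_of_ne _ _ hx, zero_mul]
      exact zero_mem _

theorem nil_mul_mul_nil_mem_span (x y : V) (a : PathAlgebra k V ⧸ I) :
    pathClass I (Path.nil : Path x x) * a * pathClass I (Path.nil : Path y y) ∈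
      Submodule.span k (Set.range fun p : Path x y => pathClass I p) := by
  obtain ⟨f, rfl⟩ := Ideal.Quotient.mk_surjective a
  have h := Submodule.mem_map_of_mem (f := (Ideal.Quotient.mkₐ k I).toLinearMap)
    (of_nil_mul_mul_of_nil_mem_span x y f)
  rw [Submodule.map_span, ← Set.range_comp] at h
  simpa [pathClass, Function.comp_def] using h

theorem exists_smul_of_path_unique {x y : V} (p : Path x y) (hp : ∀ q : Path x y, q = p)
    (a : PathAlgebra k V ⧸ I) :
    ∃ c : k, pathClass I (Path.nil : Path x x) * a * pathClass I (Path.nil : Path y y) =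
      c • pathClass I p := by
  have h := nil_mul_mul_nil_mem_span I x y a
  have hr : (Set.range fun p : Path x y => pathClass I p) = {pathClass I p} := by
    ext b
    constructor
    · rintro ⟨q, rfl⟩
      rw [hp q]
      rfl
    · rintro rfl
      exact ⟨p, rfl⟩
  rw [hr, Submodule.mem_span_singleton] at h
  obtain ⟨c, hc⟩ := h
  exact ⟨c, hc.symm⟩

/-- A function on the paths that satisfies the Leibniz rule and respects the relations extends to
a derivation. -/
theorem exists_derivation (F : QPath V → PathAlgebra k V ⧸ I)
    (hF : ∀ f ∈ I, lift F f = 0)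
    (hcorner : ∀ (x y : V) (p : Path x y),
      pathClass I (Path.nil : Path x x) * F ⟨x, y, p⟩ * pathClass I (Path.nil : Path y y) =
        F ⟨x, y, p⟩)
    (hcomp : ∀ (x y z : V) (p : Path x y) (q : Path y z), F ⟨x, z, p.comp q⟩ =
      pathClass I p * F ⟨y, z, q⟩ + F ⟨x, y, p⟩ * pathClass I q) :
    ∃ d : derivations k (PathAlgebra k V ⧸ I), ∀ (x y : V) (p : Path x y),
      d.1 (pathClass I p) = F ⟨x, y, p⟩ := by
  obtain ⟨D, hD⟩ := exists_quotient_lift I (lift F) hF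
  have hD' : ∀ (x y : V) (p : Path x y), D (pathClass I p) = F ⟨x, y, p⟩ := fun x y p => by
    rw [pathClass, hD, lift_of]
  refine ⟨⟨D, fun a b => ?_⟩, hD'⟩
  induction a using induction_pathClass with
  | h0 => simp
  | hadd a a' h h' =>
    rw [add_mul, map_add, h, h', map_add]
    noncomm_ring
  | hsmul c a h => rw [smul_mul_assoc, map_smul, h, map_smul, smul_mul_assoc, smul_mul_assoc, smul_add]
  | hof x y p =>
    induction b using induction_pathClass with
    | h0 => simp
    | hadd a a' h h' =>
      rw [mul_add, map_add, h, h', map_add]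
      noncomm_ring
    | hsmul c a h =>
      rw [mul_smul_comm, map_smul, h, map_smul, mul_smul_comm, mul_smul_comm, smul_add]
    | hof x' z q =>
      rw [hD', hD']
      by_cases h : x' = y
      · subst h
        rw [pathClass_mul, hD', hcomp]
      -- For non-composable paths both Leibniz terms vanish because the values of `F` lie in the
      -- right corners.
      · rw [pathClass_mul_of_ne I p q h, map_zero, ← hcorner x y p, ← hcorner x' z q, mul_assoc _ _
          (pathClass I q), pathClass_mul_of_ne I _ q h, mul_zero, add_zero, ← mul_assoc, ← mul_assoc,
          pathClass_mul_of_ne I p _ h, zero_mul, zero_mul]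

end QuotientAlgebra

/-! ### Normalized derivations and inner derivations. -/

section Derivations

open Quiver PathAlgebra

variable {k : Type w} {V : Type u} [Field k] [Quiver.{v} V] [DecidableEq V] [Fintype V]
  {I : Ideal (PathAlgebra k V)} [I.IsTwoSided]

/-- Derivations that agree on the trivial paths and on the arrows are equal. -/
theorem derivation_ext {d d' : derivations k (PathAlgebra k V ⧸ I)}
    (hnil : ∀ x : V, d.1 (pathClass I (Path.nil : Path x x)) =
      d'.1 (pathClass I (Path.nil : Path x x)))
    (hhom : ∀ (x y : V) (α : x ⟶ y), d.1 (pathClass I α.toPath) = d'.1 (pathClass I α.toPath)) :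
    d = d' := by
  refine Subtype.ext (LinearMap.ext fun a => ?_)
  induction a using induction_pathClass with
  | h0 => rw [map_zero, map_zero]
  | hadd a b ha hb => rw [map_add, map_add, ha, hb]
  | hsmul c a ha => rw [map_smul, map_smul, ha]
  | hof x y p =>
    induction p with
    | nil => exact hnil x
    | cons p α ih =>
      rw [← Path.comp_toPath_eq_cons, ← pathClass_mul, d.2, d'.2, ih, hhom]

variable (I) in
/-- A derivation is normalized if it vanishes on the trivial paths. -/
def IsNormalized (d : derivations k (PathAlgebra k V ⧸ I)) : Prop :=
  ∀ x : V, d.1 (pathClass I (Path.nil : Path x x)) = 0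

theorem IsNormalized.lie {d d' : derivations k (PathAlgebra k V ⧸ I)} (h : IsNormalized I d)
    (h' : IsNormalized I d') : IsNormalized I ⁅d, d'⁆ := fun x => by
  change d.1 (d'.1 _) - d'.1 (d.1 _) = 0
  rw [h, h', map_zero, map_zero, sub_zero]

theorem IsNormalized.apply_pathClass {d : derivations k (PathAlgebra k V ⧸ I)}
    (h : IsNormalized I d) {x y : V} (p : Path x y) :
    pathClass I (Path.nil : Path x x) * d.1 (pathClass I p) *
      pathClass I (Path.nil : Path y y) = d.1 (pathClass I p) := by
  have h1 := d.2 (pathClass I (Path.nil : Path x x)) (pathClass I p)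
  have h2 := d.2 (pathClass I p) (pathClass I (Path.nil : Path y y))
  rw [h, zero_mul, add_zero, pathClass_mul, Path.nil_comp] at h1
  rw [h, mul_zero, zero_add, pathClass_mul, Path.comp_nil] at h2
  rw [← h1, ← h2]

variable (k) in
/-- The inner derivation `x ↦ c x - x c`. -/
def innerDerivation {A : Type*} [Ring A] [Algebra k A] (c : A) : derivations k A :=
  ⟨LinearMap.mulLeft k c - LinearMap.mulRight k c, fun a b => by
    simp only [LinearMap.sub_apply, LinearMap.mulLeft_apply, LinearMap.mulRight_apply]
    noncomm_ring⟩

theorem innerDerivation_apply {A : Type*} [Ring A] [Algebra k A] (c x : A) :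
    (innerDerivation k c).1 x = c * x - x * c := rfl

theorem innerDerivation_mem {A : Type u} [Ring A] [Algebra k A] (c : A) :
    innerDerivation k c ∈ innerDerivations k A := ⟨c, fun _ => rfl⟩

/-- Every derivation is normalized up to an inner derivation. -/
theorem exists_normalized_sub (d : derivations k (PathAlgebra k V ⧸ I)) :
    ∃ c, IsNormalized I (d - innerDerivation k c) := by
  refine ⟨∑ x : V, d.1 (pathClass I (Path.nil : Path x x)) *
    pathClass I (Path.nil : Path x x), fun y => ?_⟩
  change d.1 _ - (innerDerivation k _).1 _ = 0
  rw [innerDerivation_apply, sub_eq_zero, Finset.sum_mul, Finset.mul_sum,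
    ← Finset.sum_sub_distrib]
  -- Leibniz applied to `e_x e_x = e_x` gives `e_x d(e_x) e_x = 0`, and applied to `e_y e_x = 0` it
  -- gives `d(e_y) e_x = -e_y d(e_x)`. Summing the resulting terms `d(e_y) e_x` over `x` yields
  -- `d(e_y)`.
  have key : ∀ x : V, d.1 (pathClass I (Path.nil : Path x x)) *
      pathClass I (Path.nil : Path x x) * pathClass I (Path.nil : Path y y) -
        pathClass I (Path.nil : Path y y) * (d.1 (pathClass I (Path.nil : Path x x)) *
          pathClass I (Path.nil : Path x x)) =
      d.1 (pathClass I (Path.nil : Path y y)) * pathClass I (Path.nil : Path x x) := by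
    intro x
    by_cases h : x = y
    · subst h
      have h1 := d.2 (pathClass I (Path.nil : Path x x)) (pathClass I (Path.nil : Path x x))
      have hi := pathClass_nil_mul_self I x
      rw [hi] at h1
      have h2 := congrArg (fun a => pathClass I (Path.nil : Path x x) * a) h1
      simp only [mul_add, ← mul_assoc, hi] at h2
      rw [left_eq_add] at h2
      rw [mul_assoc, hi, ← mul_assoc, h2, sub_zero]
    · have h1 := d.2 (pathClass I (Path.nil : Path y y)) (pathClass I (Path.nil : Path x x))
      rw [pathClass_mul_of_ne I _ _ h, map_zero] at h1
      have hi := pathClass_nil_mul_self I x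
      have h2 := congrArg (fun a => a * pathClass I (Path.nil : Path x x)) h1
      simp only [add_mul, mul_assoc, hi, zero_mul] at h2
      rw [mul_assoc, pathClass_mul_of_ne I _ _ (Ne.symm h), mul_zero, zero_sub]
      exact neg_eq_of_add_eq_zero_right h2.symm
  rw [Finset.sum_congr rfl fun x _ => key x, ← Finset.mul_sum, sum_pathClass_nil, mul_one]

theorem IsNormalized.innerDerivation_sum (l : V → k) :
    IsNormalized I (innerDerivation k (∑ x, l x • pathClass I (Path.nil : Path x x))) ∧
      ∀ (x y : V) (p : Path x y),
        (innerDerivation k (∑ x, l x • pathClass I (Path.nil : Path x x))).1 (pathClass I p) =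
          (l x - l y) • pathClass I p := by
  have h : ∀ (x y : V) (p : Path x y),
        (innerDerivation k (∑ x, l x • pathClass I (Path.nil : Path x x))).1 (pathClass I p) =
          (l x - l y) • pathClass I p := by
    intro x y p
    rw [innerDerivation_apply, Finset.sum_mul, Finset.mul_sum, Finset.sum_eq_single x,
      Finset.sum_eq_single y, smul_mul_assoc, mul_smul_comm, pathClass_mul, pathClass_mul,
      Path.nil_comp, Path.comp_nil, sub_smul]
    · intro z _ hz
      rw [mul_smul_comm, pathClass_mul_of_ne I _ _ hz, smul_zero]
    · simp
    · intro z _ hz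
      rw [smul_mul_assoc, pathClass_mul_of_ne I _ _ hz.symm, smul_zero]
    · simp
  exact ⟨fun x => by rw [h, sub_self, zero_smul], h⟩

/-- On a quiver without oriented cycles, a normalized inner derivation acts diagonally. -/
theorem IsNormalized.exists_apply_of_inner (hac : ∀ (x : V) (p : Path x x), p = Path.nil)
    {d : derivations k (PathAlgebra k V ⧸ I)} (hd : IsNormalized I d)
    (hi : d ∈ innerDerivations k (PathAlgebra k V ⧸ I)) :
    ∃ l : V → k, ∀ (x y : V) (p : Path x y), d.1 (pathClass I p) = (l x - l y) • pathClass I p := by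
  obtain ⟨c, hc⟩ := hi
  choose l hl using fun x : V => exists_smul_of_path_unique I (Path.nil : Path x x) (hac x) c
  -- Normalization means that `c` commutes with each `e_x`; since `e_x A e_x` is spanned by `e_x`,
  -- multiplication by `c` acts on `e_x` as a scalar.
  have hcomm : ∀ x : V, c * pathClass I (Path.nil : Path x x) = pathClass I Path.nil * c :=
    fun x => sub_eq_zero.1 ((hc _).symm.trans (hd x))
  have hright : ∀ x : V, c * pathClass I (Path.nil : Path x x) = l x • pathClass I Path.nil :=
    fun x => by rw [← hl, mul_assoc, hcomm, ← mul_assoc, pathClass_nil_mul_self]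
  have hleft : ∀ x : V, pathClass I (Path.nil : Path x x) * c = l x • pathClass I Path.nil :=
    fun x => by rw [← hcomm, hright]
  refine ⟨l, fun x y p => ?_⟩
  have h1 : c * pathClass I p = l x • pathClass I p := by
    rw [← Path.nil_comp p, ← pathClass_mul, ← mul_assoc, hright, smul_mul_assoc]
  have h2 : pathClass I p * c = l y • pathClass I p := by
    rw [← Path.comp_nil p, ← pathClass_mul, mul_assoc, hleft, mul_smul_comm]
  rw [hc, h1, h2, sub_smul]

end Derivations

/-! ### Derivations of a toupie algebra and their action on branches. -/

namespace IsToupie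

open Quiver PathAlgebra

variable {k : Type w} {V : Type u} [Field k] [Quiver.{v} V] [DecidableEq V] [Fintype V]
  {s t : V} {I : Ideal (PathAlgebra k V)} [I.IsTwoSided]

open Classical in
/-- The coefficient of an arrow is a well-defined linear form on `kQ / I`. -/
theorem exists_coefficient (hI : IsAdmissible I) {a b : V} (g : a ⟶ b) :
    ∃ φ : (PathAlgebra k V ⧸ I) →ₗ[k] k, ∀ (x y : V) (p : Path x y),
      φ (pathClass I p) = if (⟨x, y, p⟩ : QPath V) = ⟨a, b, g.toPath⟩ then 1 else 0 := by
  obtain ⟨φ, hφ⟩ := exists_quotient_lift I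
    (lift fun q : QPath V => if q = ⟨a, b, g.toPath⟩ then (1 : k) else 0) (fun f hf => by
      replace hf := hI.1 f hf
      induction hf using Submodule.span_induction with
      | mem f hf =>
        obtain ⟨x, y, p, hp, rfl⟩ := hf
        rw [lift_of, if_neg]
        intro h
        cases h
        simp [Hom.toPath] at hp
      | zero => rw [map_zero]
      | add f f' _ _ h h' => rw [map_add, h, h', add_zero]
      | smul c f _ h => rw [map_smul, h, smul_zero])
  exact ⟨φ, fun x y p => by rw [pathClass, hφ, lift_of]⟩

open Classical in
/-- The derivation sending an arrow `g` from the source to the sink to a parallel path, and every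
other arrow to zero. -/
theorem exists_elementary_derivation (hQ : IsToupie s t) (g : s ⟶ t)
    (φ : (PathAlgebra k V ⧸ I) →ₗ[k] k) (hφ : ∀ (x y : V) (p : Path x y),
      φ (pathClass I p) = if (⟨x, y, p⟩ : QPath V) = ⟨s, t, g.toPath⟩ then 1 else 0)
    (r : Path s t) :
    ∃ d : derivations k (PathAlgebra k V ⧸ I), IsNormalized I d ∧
      ∀ a, d.1 a = φ a • pathClass I r := by
  have hleft : ∀ (x y : V) (p : Path x y), pathClass I (Path.nil : Path x x) *
      (φ (pathClass I p) • pathClass I r) = φ (pathClass I p) • pathClass I r := by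
    intro x y p
    by_cases h : (⟨x, y, p⟩ : QPath V) = ⟨s, t, g.toPath⟩
    · cases h
      rw [mul_smul_comm, pathClass_mul, Path.nil_comp]
    · rw [hφ, if_neg h, zero_smul, mul_zero]
  have hright : ∀ (x y : V) (p : Path x y), (φ (pathClass I p) • pathClass I r) *
      pathClass I (Path.nil : Path y y) = φ (pathClass I p) • pathClass I r := by
    intro x y p
    by_cases h : (⟨x, y, p⟩ : QPath V) = ⟨s, t, g.toPath⟩
    · cases h
      rw [smul_mul_assoc, pathClass_mul, Path.comp_nil]
    · rw [hφ, if_neg h, zero_smul, zero_mul]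
  have hnil : ∀ x : V, φ (pathClass I (Path.nil : Path x x)) = 0 := by
    intro x
    rw [hφ, if_neg]
    intro h
    cases h
  obtain ⟨d, hd⟩ := exists_derivation I
    (fun q : QPath V => φ (pathClass I q.2.2) • pathClass I r)
    (fun f hf => by
      have h : lift (fun q : QPath V => φ (pathClass I q.2.2) • pathClass I r) f =
          φ (Ideal.Quotient.mk I f) • pathClass I r := by
        clear hf
        induction f using PathAlgebra.induction_on with
        | h0 => rw [map_zero, map_zero, map_zero, zero_smul]
        | hadd a b ha hb => rw [map_add, map_add, map_add, ha, hb, add_smul]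
        | hof c x y p =>
          have hc : Ideal.Quotient.mk I (c • of k p) = c • pathClass I p := rfl
          rw [map_smul, lift_of, hc, map_smul, smul_assoc]
      rw [h, Ideal.Quotient.eq_zero_iff_mem.2 hf, map_zero, zero_smul])
    (fun x y p => by rw [hleft, hright])
    (fun x y z p q => by
      -- An arrow from source to sink is a proper factor of no path, so when `p` and `q` are both
      -- nontrivial all three terms vanish.
      by_cases hp : p.length = 0
      · obtain rfl := p.eq_of_length_zero hp
        obtain rfl := p.eq_nil_of_length_zero hp
        simp only [Path.nil_comp, hnil, zero_smul, zero_mul, add_zero, hleft]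
      by_cases hq : q.length = 0
      · obtain rfl := q.eq_of_length_zero hq
        obtain rfl := q.eq_nil_of_length_zero hq
        simp only [Path.comp_nil, hnil, zero_smul, mul_zero, zero_add, hright]
      have hq0 : φ (pathClass I q) = 0 := by
        rw [hφ, if_neg]
        intro h
        cases h
        cases p with
        | nil => exact hp rfl
        | cons p a => exact (hQ.isEmpty_hom_source _).false a
      have hp0 : φ (pathClass I p) = 0 := by
        rw [hφ, if_neg]
        intro h
        cases h
        obtain rfl := hQ.path_from_sink q
        exact hq (by rw [hQ.acyclic _ q, Path.length_nil])
      have hpq : φ (pathClass I (p.comp q)) = 0 := by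
        rw [hφ, if_neg]
        intro h
        have h' := congrArg (fun q : QPath V => q.2.2.length) h
        simp only [Path.length_comp, Path.length_toPath] at h'
        omega
      simp only [hp0, hq0, hpq, zero_smul, mul_zero, zero_mul, add_zero])
  have hd' : ∀ a, d.1 a = φ a • pathClass I r := by
    intro a
    induction a using induction_pathClass with
    | h0 => rw [map_zero, map_zero, zero_smul]
    | hadd a b ha hb => rw [map_add, map_add, ha, hb, add_smul]
    | hsmul c a ha => rw [map_smul, map_smul, ha, smul_assoc]
    | hof x y p => exact hd x y p
  exact ⟨d, fun x => by rw [hd', hnil, zero_smul], hd'⟩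

/-- A diagonal function on the paths that kills the branches respects the relations. -/
theorem lift_smul_eq_zero (hQ : IsToupie s t) (c : QPath V → k)
    (hc : ∀ p : Path s t, c ⟨s, t, p⟩ • pathClass I p = 0) (f : PathAlgebra k V) (hf : f ∈ I) :
    lift (fun q : QPath V => c q • pathClass I q.2.2) f = 0 := by
  have key : ∀ (x y : V) (f : PathAlgebra k V), f ∈ I →
      f ∈ Submodule.span k (Set.range fun p : Path x y => of k p) →
      lift (fun q : QPath V => c q • pathClass I q.2.2) f = 0 := by
    intro x y f hf hfs
    by_cases h : x = s ∧ y = t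
    · obtain ⟨rfl, rfl⟩ := h
      clear hf
      induction hfs using Submodule.span_induction with
      | mem f hf =>
        obtain ⟨p, rfl⟩ := hf
        rw [lift_of, hc]
      | zero => rw [map_zero]
      | add f f' _ _ h h' => rw [map_add, h, h', add_zero]
      | smul a f _ h => rw [map_smul, h, smul_zero]
    · by_cases hne : Nonempty (Path x y)
      · obtain ⟨p₀⟩ := hne
        have h' : lift (fun q : QPath V => c q • pathClass I q.2.2) f =
            c ⟨x, y, p₀⟩ • Ideal.Quotient.mk I f := by
          clear hf
          induction hfs using Submodule.span_induction with
          | mem f hf =>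
            obtain ⟨p, rfl⟩ := hf
            obtain rfl := hQ.path_unique h p p₀
            rw [lift_of, pathClass]
          | zero => rw [map_zero, map_zero, smul_zero]
          | add f f' _ _ h h' => rw [map_add, map_add, h, h', smul_add]
          | smul a f _ h =>
            have ha : Ideal.Quotient.mk I (a • f) = a • Ideal.Quotient.mk I f := rfl
            rw [map_smul, h, ha, smul_comm]
        rw [h', Ideal.Quotient.eq_zero_iff_mem.2 hf, smul_zero]
      · have : IsEmpty (Path x y) := not_nonempty_iff.1 hne
        rw [Set.range_eq_empty, Submodule.span_empty, Submodule.mem_bot] at hfs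
        rw [hfs, map_zero]
  -- The corner components of `f` stay in `I`. Off the branches such a component is a multiple of
  -- one path, so a diagonal map sends it to a multiple of its class, which is zero.
  have hsum : f = ∑ x : V, ∑ y : V, of k (Path.nil : Path x x) * f * of k (Path.nil : Path y y) := by
    simp only [← Finset.mul_sum, ← Finset.sum_mul]
    rw [← one_def, one_mul, mul_one]
  rw [hsum, map_sum]
  refine Finset.sum_eq_zero fun x _ => ?_
  rw [map_sum]
  refine Finset.sum_eq_zero fun y _ => ?_
  exact key x y _ (I.mul_mem_right _ (I.mul_mem_left _ hf)) (of_nil_mul_mul_of_nil_mem_span x y f)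

open Classical in
/-- The derivation attached to a branch that vanishes in `kQ / I`; it kills all branches. -/
theorem exists_parallelCocycle (hQ : IsToupie s t) {x : V} (α : s ⟶ x) (q : Path x t)
    (h0 : pathClass I (α.toPath.comp q) = 0) :
    ∃ d : derivations k (PathAlgebra k V ⧸ I),
      IsParallelCocycle I d ⟨s, x, α⟩ (pathClass I α.toPath) ∧
        ∀ p : Path s t, d.1 (pathClass I p) = 0 := by
  -- Weights add under concatenation, so scaling each path by its number of occurrences of `α` obeys
  -- the Leibniz rule.
  let wt : ∀ {i j : V}, (i ⟶ j) → k := fun {i j} β =>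
    if (⟨i, j, β⟩ : QArrow V) = ⟨s, x, α⟩ then 1 else 0
  have hwt : ∀ {i j : V} (β : i ⟶ j), Path.addWeight wt β.toPath =
      if (⟨i, j, β⟩ : QArrow V) = ⟨s, x, α⟩ then 1 else 0 := by
    intro i j β
    rw [Hom.toPath, Path.addWeight_cons, Path.addWeight_nil, zero_add]
  have hne : ∀ {i j : V} (p : Path i j), i ≠ s → Path.addWeight wt p = 0 := by
    intro i j p hi
    induction p with
    | nil => exact Path.addWeight_nil _ _
    | cons p β ih =>
      rw [Path.addWeight_cons, ih, zero_add]
      refine if_neg fun h => ?_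
      cases h
      exact hQ.path_to_source p hi
  have hx : x ≠ s := by
    rintro rfl
    exact (hQ.isEmpty_hom_source _).false α
  have hst : s ≠ t := by
    rintro rfl
    exact (hQ.isEmpty_sink_hom _).false α
  -- Only the branch starting with `α` has nonzero weight, and its class is zero.
  have hbranch : ∀ p : Path s t, Path.addWeight wt p • pathClass I p = 0 := by
    intro p
    obtain ⟨z, β, q', rfl⟩ := p.exists_eq_toPath_comp hst
    have hz : z ≠ s := by
      rintro rfl
      exact (hQ.isEmpty_hom_source _).false β
    rw [Path.addWeight_comp, hwt, hne q' hz, add_zero]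
    by_cases h : (⟨s, z, β⟩ : QArrow V) = ⟨s, x, α⟩
    · cases h
      rw [hQ.path_unique_of_ne_source hx q' q, h0, smul_zero]
    · rw [if_neg h, zero_smul]
  obtain ⟨d, hd⟩ := exists_derivation I
    (fun q : QPath V => Path.addWeight wt q.2.2 • pathClass I q.2.2)
    (hQ.lift_smul_eq_zero (fun q => Path.addWeight wt q.2.2) hbranch)
    (fun x y p => by
      simp only [mul_smul_comm, smul_mul_assoc, pathClass_mul, Path.nil_comp, Path.comp_nil])
    (fun x y z p q => by
      simp only [mul_smul_comm, smul_mul_assoc, pathClass_mul, Path.addWeight_comp, add_smul]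
      rw [add_comm])
  refine ⟨d, ⟨fun y => ?_, ?_, fun β hβ => ?_⟩, fun p => ?_⟩
  · rw [hd]
    simp only [Path.addWeight_nil, zero_smul]
  · rw [hd]
    simp only [hwt, if_true, one_smul]
  · rw [hd]
    simp only [hwt]
    rw [if_neg hβ, zero_smul]
  · rw [hd, hbranch]

/-- The value lies in `e_x A e_y`, which is spanned by the class of `p`. -/
theorem exists_apply_pathClass (hQ : IsToupie s t) {d : derivations k (PathAlgebra k V ⧸ I)}
    (hd : IsNormalized I d) {x y : V} (h : ¬(x = s ∧ y = t)) (p : Path x y) :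
    ∃ c : k, d.1 (pathClass I p) = c • pathClass I p := by
  rw [← hd.apply_pathClass]
  exact exists_smul_of_path_unique I p (fun q => hQ.path_unique h q p) _

/-- On an arrow that is not a branch both derivations act by scalars. On a direct arrow `y`
vanishes, and `d` lands in the span of the branches, which `y` kills too. -/
theorem lie_parallelCocycle (hQ : IsToupie s t) {d y : derivations k (PathAlgebra k V ⧸ I)}
    (hd : IsNormalized I d) (hy : IsNormalized I y) (hy' : ∀ p : Path s t, y.1 (pathClass I p) = 0) :
    ⁅d, y⁆ = 0 := by
  refine derivation_ext (hd.lie hy) fun i j β => ?_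
  change d.1 (y.1 _) - y.1 (d.1 _) = 0
  by_cases h : i = s ∧ j = t
  · obtain ⟨rfl, rfl⟩ := h
    rw [hy', map_zero, zero_sub, neg_eq_zero, ← hd.apply_pathClass]
    have h := nil_mul_mul_nil_mem_span I i j (d.1 (pathClass I β.toPath))
    generalize pathClass I Path.nil * d.1 (pathClass I β.toPath) * pathClass I Path.nil = a at h
    induction h using Submodule.span_induction with
    | mem a ha =>
      obtain ⟨p, rfl⟩ := ha
      exact hy' p
    | zero => rw [map_zero]
    | add f f' _ _ h h' => rw [map_add, h, h', add_zero]
    | smul c f _ h => rw [map_smul, h, smul_zero]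
  · obtain ⟨c, hc⟩ := hQ.exists_apply_pathClass hd h β.toPath
    obtain ⟨c', hc'⟩ := hQ.exists_apply_pathClass hy h β.toPath
    rw [hc, hc', map_smul, map_smul, hc, hc', smul_comm, sub_self]

open Classical in
/-- A normalized derivation that commutes with all derivations up to inner ones acts on the
branches by a common scalar. -/
theorem exists_smul_branch [CharZero k] [Finite (s ⟶ t)] [Nonempty (s ⟶ t)] (hQ : IsToupie s t)
    (hI : IsAdmissible I) {z : derivations k (PathAlgebra k V ⧸ I)} (hz : IsNormalized I z)
    (hcentral : ∀ d : derivations k (PathAlgebra k V ⧸ I), IsNormalized I d →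
      ⁅z, d⁆ ∈ innerDerivations k (PathAlgebra k V ⧸ I)) :
    ∃ μ : k, ∀ p : Path s t, z.1 (pathClass I p) = μ • pathClass I p := by
  have := Fintype.ofFinite (s ⟶ t)
  choose φ hφ using fun g : s ⟶ t => exists_coefficient hI g
  have hφ' : ∀ g g' : s ⟶ t, φ g (pathClass I g'.toPath) = if g = g' then 1 else 0 := by
    intro g g'
    rw [hφ]
    refine if_congr ⟨fun h => ?_, ?_⟩ rfl rfl
    · have h' := eq_of_heq (Sigma.mk.inj (eq_of_heq (Sigma.mk.inj h).2)).2
      cases h'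
      rfl
    · rintro rfl
      rfl
  have hlong : ∀ (g : s ⟶ t) (x y : V) (p : Path x y), ¬(x = s ∧ y = t ∧ p.length = 1) →
      φ g (pathClass I p) = 0 := by
    intro g x y p hp
    rw [hφ, if_neg]
    intro h
    cases h
    exact hp ⟨rfl, rfl, rfl⟩
  obtain ⟨g₀⟩ := ‹Nonempty (s ⟶ t)›
  have hst : s ≠ t := by
    rintro rfl
    exact (hQ.isEmpty_sink_hom _).false g₀
  -- The scalar is the `g₀`-coefficient of `z(g₀)`, which does not depend on `r`.
  refine ⟨φ g₀ (z.1 (pathClass I g₀.toPath)), fun r => ?_⟩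
  obtain ⟨d, hd, hda⟩ := hQ.exists_elementary_derivation g₀ (φ g₀) (hφ g₀) r
  obtain ⟨l, hl⟩ := (hz.lie hd).exists_apply_of_inner hQ.acyclic (hcentral d hd)
  have hbr : ∀ g : s ⟶ t, φ g₀ (pathClass I g.toPath) • z.1 (pathClass I r) -
      φ g₀ (z.1 (pathClass I g.toPath)) • pathClass I r = (l s - l t) • pathClass I g.toPath := by
    intro g
    rw [← hl, ← map_smul, ← hda, ← hda]
    rfl
  -- Trace of the bracket on the direct arrows: take the `g`-coefficient of `hbr g` and sum over
  -- `g`.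
  have htrace : φ g₀ (z.1 (pathClass I r)) -
      ∑ g : s ⟶ t, φ g₀ (z.1 (pathClass I g.toPath)) * φ g (pathClass I r) =
        Fintype.card (s ⟶ t) * (l s - l t) := by
    have h := Finset.sum_congr rfl fun g (_ : g ∈ Finset.univ) => congrArg (φ g) (hbr g)
    simp only [map_sub, map_smul, hφ', smul_eq_mul, if_true, mul_one] at h
    simpa [Finset.sum_sub_distrib, mul_sub] using h
  -- If `r` is a direct arrow, the sum reduces to its own term and cancels the first. If `r` is
  -- longer, `z(r)` is a multiple of `r` by the Leibniz rule, and no `φ g` sees `r`.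
  have hzero : φ g₀ (z.1 (pathClass I r)) -
      ∑ g : s ⟶ t, φ g₀ (z.1 (pathClass I g.toPath)) * φ g (pathClass I r) = 0 := by
    obtain ⟨x, α, q, rfl⟩ := r.exists_eq_toPath_comp hst
    by_cases hx : x = t
    · subst hx
      rw [hQ.acyclic _ q, Path.comp_nil]
      simp [hφ']
    · have hxs : x ≠ s := by
        rintro rfl
        exact (hQ.isEmpty_hom_source _).false α
      have hq : q.length ≠ 0 := fun h => hx (q.eq_of_length_zero h)
      obtain ⟨c, hc⟩ := hQ.exists_apply_pathClass hz (fun h => hx h.2) α.toPath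
      obtain ⟨c', hc'⟩ := hQ.exists_apply_pathClass hz (fun h => hxs h.1) q
      have hφ0 : ∀ g, φ g (pathClass I (α.toPath.comp q)) = 0 := fun g => hlong g _ _ _ (by
        rw [Path.length_comp, Path.length_toPath]
        omega)
      rw [Finset.sum_eq_zero fun g _ => by rw [hφ0, mul_zero], sub_zero, ← pathClass_mul, z.2, hc,
        hc', mul_smul_comm, smul_mul_assoc, pathClass_mul, map_add, map_smul, map_smul, hφ0,
        smul_zero, smul_zero, add_zero]
  rw [hzero, zero_eq_mul] at htrace
  have hcard : (Fintype.card (s ⟶ t) : k) ≠ 0 :=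
    Nat.cast_ne_zero.2 (Fintype.card_pos_iff.2 ⟨g₀⟩).ne'
  have h := hbr g₀
  rw [htrace.resolve_left hcard, zero_smul, sub_eq_zero, hφ', if_pos rfl, one_smul] at h
  exact h

end IsToupie

/-! ### Reduction to the derivations attached to vanishing branches. -/

namespace IsToupie

open Quiver PathAlgebra

variable {k : Type w} {V : Type u} [Field k] [Quiver.{v} V] [DecidableEq V] [Fintype V]
  {s t : V} {I : Ideal (PathAlgebra k V)} [I.IsTwoSided]

/-- A normalized derivation acting on the branches by a common scalar is, up to an inner
derivation, a combination of the derivations attached to the vanishing branches. -/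
theorem exists_eq_sum_add_inner (hQ : IsToupie s t) (hst : s ≠ t) {ι : Type*} [Fintype ι]
    (x : ι → V) (α : ∀ i, s ⟶ x i) (q : ∀ i, Path (x i) t)
    (hzero : ∀ i, pathClass I ((α i).toPath.comp (q i)) = 0)
    (hinj : Function.Injective fun i => (⟨x i, α i⟩ : Σ y, (s ⟶ y)))
    (hsurj : ∀ (y : V) (β : s ⟶ y) (r : Path y t), pathClass I (β.toPath.comp r) = 0 →
      ∃ i, (⟨x i, α i⟩ : Σ y, (s ⟶ y)) = ⟨y, β⟩)
    (y : ι → derivations k (PathAlgebra k V ⧸ I))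
    (hy : ∀ i, IsParallelCocycle I (y i) ⟨s, x i, α i⟩ (pathClass I (α i).toPath))
    (hy' : ∀ i (p : Path s t), (y i).1 (pathClass I p) = 0)
    {z : derivations k (PathAlgebra k V ⧸ I)} (hz : IsNormalized I z) {μ : k}
    (hμ : ∀ p : Path s t, z.1 (pathClass I p) = μ • pathClass I p) :
    ∃ (c : ι → k) (e : derivations k (PathAlgebra k V ⧸ I)),
      e ∈ innerDerivations k (PathAlgebra k V ⧸ I) ∧ z = ∑ i, c i • y i + e := by
  have hw : ∀ (a b : V) (β : a ⟶ b), ∃ c : k,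
      z.1 (pathClass I β.toPath) = c • pathClass I β.toPath ∧ (a = s ∧ b = t → c = μ) := by
    intro a b β
    by_cases h : a = s ∧ b = t
    · obtain ⟨rfl, rfl⟩ := h
      exact ⟨μ, hμ _, fun _ => rfl⟩
    · obtain ⟨c, hc⟩ := hQ.exists_apply_pathClass hz h β.toPath
      exact ⟨c, hc, fun h' => absurd h' h⟩
  choose w hw hwμ using hw
  let wt : ∀ {a b : V}, (a ⟶ b) → k := fun {a b} β => w a b β
  have hwt : ∀ {a b : V} (p : Path a b),
      z.1 (pathClass I p) = Path.addWeight wt p • pathClass I p := by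
    intro a b p
    induction p with
    | nil => rw [hz, Path.addWeight_nil, zero_smul]
    | cons p β ih =>
      rw [Path.addWeight_cons, ← Path.comp_toPath_eq_cons, ← pathClass_mul, z.2, ih, hw, add_smul,
        mul_smul_comm, smul_mul_assoc, add_comm]
  have hwt1 : ∀ {a b : V} (β : a ⟶ b), Path.addWeight wt β.toPath = w a b β := by
    intro a b β
    rw [Hom.toPath, Path.addWeight_cons, Path.addWeight_nil, zero_add]
  have r : ∀ a : V, Path a t := fun a => (hQ.exists_path_to_sink a).some
  -- The potential of `a ≠ s` is the `z`-weight of the unique path to the sink, so differences of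
  -- potential give back the weights of all arrows not starting at `s`. The value `μ` at `s` is what
  -- direct arrows require, as the potential of `t` is zero.
  let l : V → k := fun a => if a = s then μ else Path.addWeight wt (r a)
  have hls : l s = μ := if_pos rfl
  have hl : ∀ a, a ≠ s → ∀ p : Path a t, l a = Path.addWeight wt p := by
    intro a ha p
    rw [hQ.path_unique_of_ne_source ha p (r a)]
    exact if_neg ha
  have hlt : l t = 0 := by rw [hl t hst.symm Path.nil, Path.addWeight_nil]
  have hxs : ∀ {a b : V} (_ : a ⟶ b), b ≠ s := by
    rintro a b β rfl
    exact (hQ.isEmpty_hom_source _).false β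
  obtain ⟨e, hei, hen, he⟩ : ∃ e ∈ innerDerivations k (PathAlgebra k V ⧸ I), IsNormalized I e ∧
      ∀ (a b : V) (p : Path a b), e.1 (pathClass I p) = (l a - l b) • pathClass I p :=
    ⟨_, innerDerivation_mem _, IsNormalized.innerDerivation_sum l⟩
  have hsum : ∀ (c : ι → k) (a : PathAlgebra k V ⧸ I),
      (∑ i, c i • y i + e).1 a = ∑ i, c i • (y i).1 a + e.1 a := by
    intro c a
    let ev : derivations k (PathAlgebra k V ⧸ I) →ₗ[k] PathAlgebra k V ⧸ I :=
      { toFun := fun d => d.1 a, map_add' := fun _ _ => rfl, map_smul' := fun _ _ => rfl }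
    change ev (∑ i, c i • y i + e) = _
    rw [map_add, map_sum]
    simp only [map_smul]
    rfl
  -- Each coefficient is the discrepancy on `α i` between `z` and the inner derivation of the
  -- potential.
  refine ⟨fun i => w _ _ (α i) - (μ - l (x i)), e, hei,
    derivation_ext (fun a => ?_) fun a b β => ?_⟩
  · rw [hsum, hz, hen, Finset.sum_eq_zero fun i _ => by rw [(hy i).1, smul_zero], add_zero]
  rw [hsum, he, hw]
  by_cases ha : a = s
  · subst ha
    by_cases hb : b = t
    · subst hb
      rw [Finset.sum_eq_zero fun i _ => by rw [hy', smul_zero], hwμ _ _ _ ⟨rfl, rfl⟩, hls, hlt,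
        sub_zero, zero_add]
    rw [hls]
    by_cases h0 : pathClass I (β.toPath.comp (r b)) = 0
    · obtain ⟨i, hi⟩ := hsurj b β (r b) h0
      obtain ⟨hb', hβ⟩ := Sigma.mk.inj hi
      subst hb'
      obtain rfl := eq_of_heq hβ
      rw [Finset.sum_eq_single i, (hy i).2.1, ← add_smul, sub_add_cancel]
      · intro j _ hj
        rw [(hy j).2.2 ⟨_, _, α i⟩, smul_zero]
        intro h
        exact hj (hinj (eq_of_heq (Sigma.mk.inj h).2)).symm
      · exact fun h => absurd (Finset.mem_univ i) h
    · rw [Finset.sum_eq_zero, zero_add]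
      -- A branch with nonzero class must have total weight `μ`, so the potential already accounts
      -- for its first arrow.
      · have h := (hwt _).symm.trans (hμ (β.toPath.comp (r b)))
        rw [Path.addWeight_comp, hwt1, ← sub_eq_zero, ← sub_smul] at h
        have h' := (smul_eq_zero.1 h).resolve_right h0
        rw [hl b (hxs β) (r b), ← sub_eq_zero.1 h', add_sub_cancel_right]
      · intro i _
        rw [(hy i).2.2 ⟨_, _, β⟩, smul_zero]
        intro h
        have h' := eq_of_heq (Sigma.mk.inj h).2
        obtain ⟨hb', hβ⟩ := Sigma.mk.inj h'
        subst hb'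
        obtain rfl := eq_of_heq hβ
        rw [hQ.path_unique_of_ne_source (hxs (α i)) (r _) (q i)] at h0
        exact h0 (hzero i)
  · rw [Finset.sum_eq_zero, zero_add, hl a ha (β.toPath.comp (r b)), Path.addWeight_comp, hwt1,
      hl b (hxs β) (r b), add_sub_cancel_right]
    intro i _
    rw [(hy i).2.2 ⟨_, _, β⟩, smul_zero]
    intro h
    exact ha (Sigma.mk.inj h).1

end IsToupie

/-! ### Passage to `HH1` and conclusion. -/

theorem mk_eq_mk_sub_innerDerivation {k : Type w} [Field k] {A : Type u} [Ring A] [Algebra k A]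
    (d : derivations k A) (c : A) :
    (LieSubmodule.Quotient.mk d : HH1 k A) =
      LieSubmodule.Quotient.mk (d - innerDerivation k c) := by
  have h : LieSubmodule.Quotient.mk' (innerDerivations k A) d =
      LieSubmodule.Quotient.mk' (innerDerivations k A) (d - innerDerivation k c) := by
    rw [map_sub, (LieSubmodule.Quotient.mk_eq_zero _).2 (innerDerivation_mem c), sub_zero]
  exact h

/-- The bracket of classes can be computed on any representatives, so exact commutation with one
representative of each class suffices. -/
theorem mk_mem_center {k : Type w} [Field k] {A : Type u} [Ring A] [Algebra k A]
    {y : derivations k A} (h : ∀ d : derivations k A, ∃ c : A, ⁅d - innerDerivation k c, y⁆ = 0) :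
    (LieSubmodule.Quotient.mk y : HH1 k A) ∈ (LieAlgebra.center k (HH1 k A)).toSubmodule := by
  refine (LieModule.mem_maxTrivSubmodule k (HH1 k A) (HH1 k A) _).2 fun D => ?_
  obtain ⟨d, rfl⟩ : ∃ d : derivations k A, (LieSubmodule.Quotient.mk d : HH1 k A) = D :=
    LieSubmodule.Quotient.surjective_mk' (innerDerivations k A) D
  obtain ⟨c, hc⟩ := h d
  rw [mk_eq_mk_sub_innerDerivation d c, ← LieSubmodule.Quotient.mk_bracket, hc]
  exact LieSubmodule.Quotient.mk_eq_zero'.2 (zero_mem _)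

theorem lie_mem_innerDerivations_of_mk_mem_center {k : Type w} [Field k] {A : Type u} [Ring A]
    [Algebra k A] {z : derivations k A}
    (hz : (LieSubmodule.Quotient.mk z : HH1 k A) ∈ (LieAlgebra.center k (HH1 k A)).toSubmodule)
    (d : derivations k A) : ⁅z, d⁆ ∈ innerDerivations k A := by
  have h := (LieModule.mem_maxTrivSubmodule k (HH1 k A) (HH1 k A) _).1 hz
    (LieSubmodule.Quotient.mk d)
  rw [← LieSubmodule.Quotient.mk_bracket, LieSubmodule.Quotient.mk_eq_zero'] at h
  rw [← lie_skew]
  exact neg_mem h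

theorem mk_mem_span_of_eq_sum_add {k : Type w} [Field k] {A : Type u} [Ring A] [Algebra k A]
    {ι : Type*} [Fintype ι] (y : ι → derivations k A) {z e : derivations k A} {c : ι → k}
    (he : e ∈ innerDerivations k A) (hz : z = ∑ i, c i • y i + e) :
    (LieSubmodule.Quotient.mk z : HH1 k A) ∈
      Submodule.span k (Set.range fun i => (LieSubmodule.Quotient.mk (y i) : HH1 k A)) := by
  have h : LieSubmodule.Quotient.mk' (innerDerivations k A) z =
      ∑ i, c i • LieSubmodule.Quotient.mk' (innerDerivations k A) (y i) := by
    rw [hz, map_add, map_sum, (LieSubmodule.Quotient.mk_eq_zero _).2 he, add_zero]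
    simp only [map_smul]
  have h' : (LieSubmodule.Quotient.mk z : HH1 k A) =
      ∑ i, c i • (LieSubmodule.Quotient.mk (y i) : HH1 k A) := h
  rw [h']
  exact Submodule.sum_mem _ fun i _ => Submodule.smul_mem _ _ (Submodule.subset_span ⟨i, rfl⟩)

theorem mainTheorem7 {k : Type w} [Field k] [CharZero k]
    {V : Type u} [Quiver.{v} V] [Fintype V] [DecidableEq V] [∀ x y : V, Finite (x ⟶ y)]
    (s t : V) (hQ : IsToupie s t)
    (I : Ideal (PathAlgebra k V)) [I.IsTwoSided] (hI : IsAdmissible I)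
    (ha : 0 < Nat.card (s ⟶ t)) :
    ∃ y : {p : Quiver.Path s t // ContainsMonomialRelation I p} → derivations k (PathAlgebra k V ⧸ I),
      (∀ p, ∃ (x : V) (α : s ⟶ x) (q : Quiver.Path x t), p.1 = α.toPath.comp q ∧
        IsParallelCocycle I (y p) ⟨s, x, α⟩ (pathClass I α.toPath)) ∧
      (LieAlgebra.center k (HH1 k (PathAlgebra k V ⧸ I))).toSubmodule =
        Submodule.span k (Set.range fun p =>
          (LieSubmodule.Quotient.mk (y p) : HH1 k (PathAlgebra k V ⧸ I))) := by
  have hne : Nonempty (s ⟶ t) := (Nat.card_pos_iff.1 ha).1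
  have hst : s ≠ t := by
    rintro rfl
    exact (hQ.isEmpty_sink_hom _).false hne.some
  choose x α q hq using
    fun p : {p : Quiver.Path s t // ContainsMonomialRelation I p} => p.1.exists_eq_toPath_comp hst
  have hzero : ∀ p, pathClass I ((α p).toPath.comp (q p)) = 0 := fun p => by
    rw [← hq]
    exact pathClass_eq_zero_of_containsMonomialRelation I p.2
  choose y hy hy' using fun p => hQ.exists_parallelCocycle (α p) (q p) (hzero p)
  have hxs : ∀ {a b : V} (_ : a ⟶ b), b ≠ s := by
    rintro a b β rfl
    exact (hQ.isEmpty_hom_source _).false β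
  -- A branch is determined by its first arrow; this also makes the index set of the sum finite.
  have hinj : Function.Injective fun p => (⟨x p, α p⟩ : Σ z, (s ⟶ z)) := by
    intro p p' h
    have key : ∀ {a b : V} (β : s ⟶ a) (β' : s ⟶ b) (r : Quiver.Path a t) (r' : Quiver.Path b t),
        (⟨a, β⟩ : Σ z, (s ⟶ z)) = ⟨b, β'⟩ → β.toPath.comp r = β'.toPath.comp r' := by
      intro a b β β' r r' h
      cases h
      rw [hQ.path_unique_of_ne_source (hxs β) r r']
    exact Subtype.ext (by rw [hq p, hq p', key _ _ _ _ h])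
  have := Finite.of_injective _ hinj
  have := Fintype.ofFinite {p : Quiver.Path s t // ContainsMonomialRelation I p}
  refine ⟨y, fun p => ⟨x p, α p, q p, hq p, hy p⟩, le_antisymm ?_ (Submodule.span_le.2 ?_)⟩
  · intro Z hZ
    obtain ⟨z', rfl⟩ : ∃ z' : derivations k (PathAlgebra k V ⧸ I), LieSubmodule.Quotient.mk z' = Z :=
      LieSubmodule.Quotient.surjective_mk' (innerDerivations k _) Z
    obtain ⟨c, hz⟩ := exists_normalized_sub z'
    rw [mk_eq_mk_sub_innerDerivation z' c] at hZ ⊢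
    obtain ⟨μ, hμ⟩ := hQ.exists_smul_branch hI hz fun d _ =>
      lie_mem_innerDerivations_of_mk_mem_center hZ d
    -- A branch with zero class counts as containing a monomial relation, with the whole branch as
    -- the subpath, so every vanishing branch is indexed.
    obtain ⟨c, e, he, hze⟩ := hQ.exists_eq_sum_add_inner hst x α q hzero hinj
      (fun b β r h0 => ⟨⟨_, containsMonomialRelation_of_pathClass_eq_zero I h0⟩,
        (Quiver.Path.toPath_comp_inj (hq ⟨_, _⟩)).symm⟩) y hy hy' hz hμ
    exact mk_mem_span_of_eq_sum_add y he hze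
  · rintro _ ⟨p, rfl⟩
    refine mk_mem_center fun d => ?_
    obtain ⟨c, hd⟩ := exists_normalized_sub d
    exact ⟨c, hQ.lie_parallelCocycle hd (hy p).1 (hy' p)⟩
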